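/- Let $1<q<\infty$ with $q\neq 2$, let $G=(V,E)$ be a finite simple graph with $V\neq\emptyset$, and let $p=(p_v)_{v\in V}$ be a family of points of $\mathbb{R}^2$ (a placement of $G$), where $\mathbb{R}^2$ carries the norm $\|\cdot\|_q$. The *rigidity matrix* $R_q(G,p)$ is the $|E|\times 2|V|$ real matrix whose row for an edge $vw$ has the entries $(p_v-p_w)^{(q-1)}$ in the two columns of $v$, $-(p_v-p_w)^{(q-1)}$ in the two columns of $w$, and $0$ elsewhere, where $a^{(k)}=(\operatorname{sgn}(a_1)|a_1|^k,\operatorname{sgn}(a_2)|a_2|^k)$. The framework $(G,p)$ is *regular* if $\operatorname{rank}R_q(G,p)\ge\operatorname{rank}R_q(G,p')$ for every placement $p'$ of $G$. An *infinitesimal flex* of $(G,p)$ is a family $u=(u_v)_{v\in V}$ in $\mathbb{R}^2$ such that $\|(p_v+tu_v)-(p_w+tu_w)\|_q-\|p_v-p_w\|_q=o(t)$ as $t\to0$ for every edge $vw\in E$. A *rigid motion* is a family of continuous paths $\gamma_x:[-1,1]\to\mathbb{R}^2$ $(x\in\mathbb{R}^2)$, each differentiable at $0$ with $\gamma_x(0)=x$,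 such that $\|\gamma_x(t)-\gamma_y(t)\|_q=\|x-y\|_q$ for all $x,y\in\mathbb{R}^2$ and $t\in[-1,1]$. A flex $u$ is *trivial* if there is a rigid motion with $u_v=\gamma_{p_v}'(0)$ for all $v\in V$. The framework $(G,p)$ is *infinitesimally rigid* if all its infinitesimal flexes are trivial, and *infinitesimally flexible* otherwise; it is *minimally infinitesimally rigid* if it is infinitesimally rigid and, for every edge $e\in E$, the framework $(G-e,p)$ is infinitesimally flexible. **Theorem.** If $(G,p)$ is regular, then $(G,p)$ is minimally infinitesimally rigid if and only if $G$ is $(2,2)$-tight, that is, $|E|=2|V|-2$ and $|E(H)|\le 2|V(H)|-2$ for every subgraph $H=(V(H),E(H))$ of $G$ with $V(H)\neq\emptyset$. -/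

import Mathlib

open scoped ENNReal Topology

namespace BarJoint

section NormedSpace

variable {V X : Type*} [NormedAddCommGroup X] [NormedSpace ℝ X]

/-- `u` is an infinitesimal flex of the framework `(G, p)`: the edge lengths of `(G, p + t u)`
differ from those of `(G, p)` by `o(t)` as `t → 0`. -/
def IsInfinitesimalFlex (G : SimpleGraph V) (p u : V → X) : Prop :=
  ∀ v w : V, G.Adj v w →
    (fun t : ℝ => ‖(p v + t • u v) - (p w + t • u w)‖ - ‖p v - p w‖) =o[𝓝 0] (fun t : ℝ => t)

/-- A rigid motion of `X`. Only the values of the paths on `[-1, 1]` matter. -/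
structure IsRigidMotion (γ : X → ℝ → X) : Prop where
  continuousOn : ∀ x, ContinuousOn (γ x) (Set.Icc (-1) 1)
  differentiableAt : ∀ x, DifferentiableAt ℝ (γ x) 0
  map_zero : ∀ x, γ x 0 = x
  norm_sub : ∀ t ∈ Set.Icc (-1 : ℝ) 1, ∀ x y, ‖γ x t - γ y t‖ = ‖x - y‖

/-- `u` is the restriction to the placement `p` of the vector field `x ↦ γ_x'(0)` of a rigid
motion. -/
def IsTrivial (p u : V → X) : Prop :=
  ∃ γ : X → ℝ → X, IsRigidMotion γ ∧ ∀ v, u v = deriv (γ (p v)) 0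

/-- `(G, p)` has a non-trivial infinitesimal flex. -/
def InfinitesimallyFlexible (G : SimpleGraph V) (p : V → X) : Prop :=
  ∃ u : V → X, IsInfinitesimalFlex G p u ∧ ¬ IsTrivial p u

/-- `(G, p)` has no non-trivial infinitesimal flex. -/
def InfinitesimallyRigid (G : SimpleGraph V) (p : V → X) : Prop :=
  ¬ InfinitesimallyFlexible G p

/-- `(G, p)` is infinitesimally rigid, and removing any single edge makes it flexible. -/
def MinimallyInfinitesimallyRigid (G : SimpleGraph V) (p : V → X) : Prop :=
  InfinitesimallyRigid G p ∧
    ∀ e ∈ G.edgeSet, InfinitesimallyFlexible (G.deleteEdges {e}) p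

end NormedSpace

section RigidityMatrix

/-- The signed power `sgn(a) |a|^k`. -/
noncomputable def signedPow (k a : ℝ) : ℝ := Real.sign a * |a| ^ k

theorem signedPow_neg (k a : ℝ) : signedPow k (-a) = -signedPow k a := by
  simp [signedPow, Real.sign_neg]

variable {V : Type*} [DecidableEq V] {d : ℕ}

/-- The entry of the rigidity matrix in the row of the edge `v_i v_j` and the column of the
`k`-th coordinate of the vertex `v`: the row carries `(p_i - p_j)^{(q-1)}` in the columns of `v_i`,
`-(p_i - p_j)^{(q-1)}` in the columns of `v_j`, and zeros elsewhere. This does not depend on the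
order of the two end points. -/
noncomputable def rigidityEntry (q : ℝ≥0∞) (p : V → PiLp q (fun _ : Fin d => ℝ))
    (e : Sym2 V) (v : V) (k : Fin d) : ℝ :=
  Sym2.lift ⟨fun i j =>
    (if v = i then signedPow (q.toReal - 1) (p i k - p j k) else 0) -
      (if v = j then signedPow (q.toReal - 1) (p i k - p j k) else 0), by
    intro i j
    have h : signedPow (q.toReal - 1) (p j k - p i k)
        = -signedPow (q.toReal - 1) (p i k - p j k) := by
      rw [← signedPow_neg, neg_sub]
    simp only [h]
    split_ifs <;> ring⟩ e

/-- The rigidity matrix `R_q(G, p)`, of size `|E| × d|V|`. -/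
noncomputable def rigidityMatrix (q : ℝ≥0∞) (G : SimpleGraph V)
    (p : V → PiLp q (fun _ : Fin d => ℝ)) : Matrix G.edgeSet (V × Fin d) ℝ :=
  Matrix.of fun e c => rigidityEntry q p e c.1 c.2

/-- `(G, p)` is regular: the rank of its rigidity matrix is maximal over all realisations
of `G`. -/
def IsRegular [Fintype V] (q : ℝ≥0∞) (G : SimpleGraph V)
    (p : V → PiLp q (fun _ : Fin d => ℝ)) : Prop :=
  ∀ p' : V → PiLp q (fun _ : Fin d => ℝ),
    (rigidityMatrix q G p').rank ≤ (rigidityMatrix q G p).rank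

end RigidityMatrix

/-- `|E(H)| ≤ 2|V(H)| - 2` for all (non-empty) subgraphs `H` of `G`. -/
def IsTwoTwoSparse {V : Type*} (G : SimpleGraph V) : Prop :=
  ∀ H : G.Subgraph, H.verts.Nonempty →
    (H.edgeSet.ncard : ℤ) ≤ 2 * (H.verts.ncard : ℤ) - 2

/-- `G` is `(2,2)`-sparse and `|E| = 2|V| - 2`. -/
def IsTwoTwoTight {V : Type*} (G : SimpleGraph V) : Prop :=
  IsTwoTwoSparse G ∧ (G.edgeSet.ncard : ℤ) = 2 * (Nat.card V : ℤ) - 2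

end BarJoint

/-
Call a framework independent if the rows of its rigidity matrix are. A regular framework
is minimally rigid exactly if it is independent with `|E| = 2|V| - 2`.

Away from edges of length zero, the infinitesimal flexes are the kernel of the rigidity matrix, and
for `q ≠ 2` the trivial ones are the translations. Hence an independent framework is rigid exactly
if `|E| = 2|V| - 2`, and applying the count to induced subgraphs shows that it is `(2,2)`-sparse.

The core is the converse: every `(2,2)`-sparse graph has an independent placement. Vertices of
degree at most two can be removed, and a proper tight vertex set can be contracted, the tight part
being scaled down to an infinitesimal size and put back in place of the contracted vertex. If
neither is possible, then the graph is `K₄`, for which `q ≠ 2` supplies an explicit placement, or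
it has a vertex `v` of degree three with non-adjacent neighbours `a`, `b` such that `G - v + ab` is
still sparse; then `v` is put back on the line through `a` and `b`.

Finally, let a regular framework be minimally rigid, and let `H` be a maximal independent subgraph.
If an edge `ab` were missing from `H`, then by regularity `H + ab` would not be sparse, so `a` and
`b` would lie in a tight, hence rigid, subset of `H`. Every flex of `(G - ab, p)` would then agree
on `a` and `b` and so be a flex of `(G, p)`, contradicting minimality.
-/

namespace BarJoint

section SignedPow

variable {r : ℝ}

theorem signedPow_eq (r x : ℝ) : signedPow r x = |x| ^ (r - 1) * x := by
  rcases eq_or_ne x 0 with rfl | hx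
  · simp [signedPow]
  · rw [signedPow, Real.rpow_sub_one (abs_ne_zero.2 hx)]
    rcases hx.lt_or_gt with hx | hx
    · rw [Real.sign_of_neg hx, abs_of_neg hx]
      field_simp
    · rw [Real.sign_of_pos hx, abs_of_pos hx]
      field_simp

@[simp]
theorem signedPow_zero : signedPow r 0 = 0 := by simp [signedPow]

@[simp]
theorem signedPow_one : signedPow r 1 = 1 := by simp [signedPow]

theorem signedPow_of_pos {x : ℝ} (hx : 0 < x) : signedPow r x = x ^ r := by
  rw [signedPow, Real.sign_of_pos hx, abs_of_pos hx, one_mul]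

theorem signedPow_mul (x y : ℝ) : signedPow r (x * y) = signedPow r x * signedPow r y := by
  simp only [signedPow_eq, abs_mul, Real.mul_rpow (abs_nonneg x) (abs_nonneg y)]
  ring

theorem abs_signedPow (hr : r ≠ 0) (x : ℝ) : |signedPow r x| = |x| ^ r := by
  rcases eq_or_ne x 0 with rfl | hx
  · simp [hr]
  · rw [signedPow_eq, abs_mul, abs_of_nonneg (by positivity),
      ← Real.rpow_add_one (abs_ne_zero.2 hx), sub_add_cancel]

theorem signedPow_eq_zero_iff {x : ℝ} : signedPow r x = 0 ↔ x = 0 := by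
  rw [signedPow_eq, mul_eq_zero, or_iff_right_of_imp]
  exact fun h => abs_eq_zero.1 ((Real.rpow_eq_zero_iff_of_nonneg (abs_nonneg x)).1 h).1

theorem signedPow_signedPow_inv (hr : r ≠ 0) (x : ℝ) : signedPow r⁻¹ (signedPow r x) = x := by
  rcases eq_or_ne x 0 with rfl | hx
  · simp
  · rw [signedPow_eq, abs_signedPow hr, ← Real.rpow_mul (abs_nonneg x), signedPow_eq, ← mul_assoc,
      ← Real.rpow_add (abs_pos.2 hx), mul_sub, mul_inv_cancel₀ hr, mul_one,
      sub_add_sub_cancel, sub_self, Real.rpow_zero, one_mul]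

theorem signedPow_injective (hr : r ≠ 0) : Function.Injective (signedPow r) :=
  Function.LeftInverse.injective (signedPow_signedPow_inv hr)

theorem continuous_signedPow (hr : 0 < r) : Continuous (signedPow r) := by
  have eq_sub : signedPow r = fun x => max x 0 ^ r - max (-x) 0 ^ r := by
    funext x
    rcases lt_trichotomy x 0 with hx | rfl | hx
    · simp [signedPow, Real.sign_of_neg hx, abs_of_neg hx, hx.le, hr.ne']
    · simp
    · simp [signedPow, Real.sign_of_pos hx, abs_of_pos hx, hx.le, hr.ne']
  rw [eq_sub]
  exact ((continuous_id.max continuous_const).rpow_const fun _ => Or.inr hr.le).sub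
    ((continuous_neg.max continuous_const).rpow_const fun _ => Or.inr hr.le)

theorem signedPow_two_ne_two (hr : r ≠ 1) : signedPow r 2 ≠ 2 := by
  rw [signedPow_of_pos two_pos]
  exact fun h => hr ((Real.rpow_right_inj two_pos (by norm_num)).1 (h.trans (Real.rpow_one 2).symm))

end SignedPow

section FirstOrder

variable {ι : Type*} [Fintype ι] {q : ℝ≥0∞} [Fact (1 ≤ q)]

theorem exists_hasDerivAt_norm_comp (hq : 1 < q.toReal) {h : ℝ → PiLp q (fun _ : ι => ℝ)}
    {w : PiLp q (fun _ : ι => ℝ)} {t₀ : ℝ} (hh : HasDerivAt h w t₀) (h0 : h t₀ ≠ 0) :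
    ∃ c : ℝ, c ≠ 0 ∧
      HasDerivAt (fun t => ‖h t‖) (c * ∑ k, signedPow (q.toReal - 1) (h t₀ k) * w k) t₀ := by
  have hq0 : 0 < q.toReal := zero_lt_one.trans hq
  have hcoord (k : ι) : HasDerivAt (fun t => h t k) (w k) t₀ :=
    (PiLp.proj (𝕜 := ℝ) q (fun _ : ι => ℝ) k).hasFDerivAt.comp_hasDerivAt t₀ hh
  have hsum : HasDerivAt (fun t => ∑ k, |h t k| ^ q.toReal)
      (∑ k, q.toReal * |h t₀ k| ^ (q.toReal - 2) * h t₀ k * w k) t₀ :=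
    HasDerivAt.fun_sum fun k _ => HasDerivAt.comp (h₂ := fun x : ℝ => |x| ^ q.toReal) t₀
      (hasDerivAt_abs_rpow (h t₀ k) hq) (hcoord k)
  have hpos : 0 < ∑ k, |h t₀ k| ^ q.toReal := by
    obtain ⟨k, hk⟩ : ∃ k, h t₀ k ≠ 0 := by
      by_contra! hc
      exact h0 (by ext k; exact hc k)
    exact Finset.sum_pos' (fun i _ => by positivity) ⟨k, Finset.mem_univ _, by positivity⟩
  have hnorm (t : ℝ) : ‖h t‖ = (∑ k, |h t k| ^ q.toReal) ^ (1 / q.toReal) := by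
    simp only [PiLp.norm_eq_sum hq0, Real.norm_eq_abs]
  refine ⟨(∑ k, |h t₀ k| ^ q.toReal) ^ (1 / q.toReal - 1), (Real.rpow_pos_of_pos hpos _).ne', ?_⟩
  simp only [hnorm]
  convert hsum.rpow_const (p := 1 / q.toReal) (Or.inl hpos.ne') using 1
  simp only [signedPow_eq, sub_sub, one_add_one_eq_two, mul_assoc, ← Finset.mul_sum]
  field_simp

theorem isLittleO_norm_sub_iff (hq : 1 < q.toReal) {x y u v : PiLp q (fun _ : ι => ℝ)}
    (hxy : x ≠ y) :
    (fun t : ℝ => ‖(x + t • u) - (y + t • v)‖ - ‖x - y‖) =o[𝓝 0] (fun t : ℝ => t) ↔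
      ∑ k, signedPow (q.toReal - 1) (x k - y k) * (u k - v k) = 0 := by
  have hline (z w : PiLp q (fun _ : ι => ℝ)) : HasDerivAt (fun t : ℝ => z + t • w) w 0 := by
    simpa using ((hasDerivAt_id (0 : ℝ)).smul_const w).const_add z
  obtain ⟨c, hc, hderiv⟩ := exists_hasDerivAt_norm_comp hq ((hline x u).sub (hline y v))
    (by simpa [sub_eq_zero] using hxy)
  simp only [Pi.sub_apply, zero_smul, add_zero, PiLp.sub_apply] at hderiv
  have hiff : (fun t : ℝ => ‖(x + t • u) - (y + t • v)‖ - ‖x - y‖) =o[𝓝 0] (fun t : ℝ => t) ↔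
      HasDerivAt (fun t : ℝ => ‖(x + t • u) - (y + t • v)‖) 0 0 := by
    simp [hasDerivAt_iff_isLittleO]
  rw [hiff]
  refine ⟨fun h => (mul_eq_zero.1 (hderiv.unique h)).resolve_left hc, fun h => ?_⟩
  rwa [h, mul_zero] at hderiv

/-- If the velocity field preserves distances to first order, then its coordinate `i` does not
change along coordinate `k`: the change over a step of length `s` is a multiple of `signedPow r s`,
while two unit steps give twice the change of one. -/
theorem apply_add_single_of_firstOrder [DecidableEq ι] {r : ℝ} (hr : r ≠ 1)
    {F : (ι → ℝ) → ι → ℝ}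
    (hF : ∀ x y, ∑ k, signedPow r (x k - y k) * (F x k - F y k) = 0)
    (x : ι → ℝ) (k i : ι) (s : ℝ) : F (x + Pi.single k s) i = F x i := by
  have along (x k s) : F (x + Pi.single k s) k = F x k := by
    rcases eq_or_ne s 0 with rfl | hs
    · simp
    have h := hF (x + Pi.single k s) x
    rw [Finset.sum_eq_single k (fun j _ hj => by simp [hj]) (by simp)] at h
    simpa [signedPow_eq_zero_iff, hs, sub_eq_zero] using h
  rcases eq_or_ne i k with rfl | hik
  · exact along x i s
  have cross (x s t) : signedPow r s * (F (x + Pi.single i t) k - F x k) +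
      signedPow r t * (F (x + Pi.single k s) i - F x i) = 0 := by
    have h := hF (x + Pi.single i t + Pi.single k s) x
    rw [Finset.sum_eq_add k i hik.symm (fun j _ hj => by simp [hj.1, hj.2]) (by simp) (by simp),
      along, add_right_comm, along] at h
    simpa [hik, hik.symm] using h
  have unit : F (x + Pi.single i 1) k = F x k := by
    have h₁ := cross x 1 1
    have h₂ := cross (x + Pi.single k 1) 1 1
    have h₃ := cross x 2 1
    rw [add_right_comm, along, along, add_assoc, ← Pi.single_add, one_add_one_eq_two] at h₂
    simp only [signedPow_one, one_mul] at h₁ h₂ h₃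
    have h : (signedPow r 2 - 2) * (F (x + Pi.single i 1) k - F x k) = 0 := by
      linear_combination h₃ - h₁ - h₂
    exact sub_eq_zero.1
      ((mul_eq_zero.1 h).resolve_left (sub_ne_zero.2 (signedPow_two_ne_two hr)))
  have h := cross x s 1
  rw [unit, sub_self, mul_zero, zero_add, signedPow_one, one_mul] at h
  exact sub_eq_zero.1 h

theorem eq_of_firstOrder {r : ℝ} (hr : r ≠ 1) {F : (ι → ℝ) → ι → ℝ}
    (hF : ∀ x y, ∑ k, signedPow r (x k - y k) * (F x k - F y k) = 0) (x y : ι → ℝ) :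
    F x = F y := by
  classical
  have add_sum (s : Finset ι) : F (y + ∑ k ∈ s, Pi.single k (x k - y k)) = F y := by
    induction s using Finset.induction_on with
    | empty => simp
    | insert k s hk ih =>
      rw [Finset.sum_insert hk, add_comm (Pi.single k _), ← add_assoc, ← ih]
      funext i
      exact apply_add_single_of_firstOrder hr hF _ k i _
  rw [← add_sum Finset.univ, Finset.univ_sum_single (fun k => x k - y k)]
  congr 1
  ext k
  simp

/-- In `ℓ_q` with `q ≠ 2` the velocity fields of rigid motions are the constant ones: there are no
infinitesimal rotations. -/
theorem isTrivial_iff {V : Type*} [Nonempty V] (hq : 1 < q.toReal) (hq2 : q.toReal ≠ 2)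
    {p u : V → PiLp q (fun _ : ι => ℝ)} : IsTrivial p u ↔ ∀ a b, u a = u b := by
  constructor
  · rintro ⟨γ, hγ, hu⟩ a b
    have firstOrder (x y : PiLp q (fun _ : ι => ℝ)) :
        ∑ k, signedPow (q.toReal - 1) (x k - y k) * (deriv (γ x) 0 k - deriv (γ y) 0 k) = 0 := by
      rcases eq_or_ne x y with rfl | hxy
      · simp
      obtain ⟨c, hc, hderiv⟩ := exists_hasDerivAt_norm_comp hq
        ((hγ.differentiableAt x).hasDerivAt.sub (hγ.differentiableAt y).hasDerivAt)
        (by simpa [hγ.map_zero, sub_eq_zero] using hxy)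
      have hconst : (fun t => ‖(γ x - γ y) t‖) =ᶠ[𝓝 0] fun _ => ‖x - y‖ := by
        filter_upwards [Icc_mem_nhds (show (-1 : ℝ) < 0 by norm_num) zero_lt_one] with t ht
        exact hγ.norm_sub t ht x y
      have := (hderiv.congr_of_eventuallyEq hconst.symm).unique (hasDerivAt_const _ _)
      simpa [hγ.map_zero, hc] using this
    have hr : q.toReal - 1 ≠ 1 := fun h => hq2 (by linarith)
    ext k
    rw [hu, hu]
    exact congrFun (eq_of_firstOrder hr
      (F := fun x k => deriv (γ (WithLp.toLp q x)) (0 : ℝ) k)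
      (fun x y => firstOrder (WithLp.toLp q x) (WithLp.toLp q y)) (p a) (p b)) k
  · intro h
    obtain ⟨v⟩ := ‹Nonempty V›
    have hline (x : PiLp q (fun _ : ι => ℝ)) : HasDerivAt (fun t : ℝ => x + t • u v) (u v) 0 := by
      simpa using ((hasDerivAt_id (0 : ℝ)).smul_const (u v)).const_add x
    exact ⟨fun x t => x + t • u v, ⟨fun x => by fun_prop, fun x => (hline x).differentiableAt,
      fun x => by simp, fun t _ x y => by simp⟩, fun w => by rw [(hline _).deriv, h w v]⟩

end FirstOrder

section DotProduct

variable {K ι n : Type*} [Field K] [Fintype n] {F : ι → n → K} {s : Set ι}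

theorem linearIndepOn_iff_forall_exists_dotProduct_eq :
    LinearIndepOn K F s ↔ ∀ ℓ : ι → K, ∃ u : n → K, ∀ i ∈ s, F i ⬝ᵥ u = ℓ i := by
  classical
  constructor
  · intro h ℓ
    obtain ⟨g, hg⟩ := (Finsupp.linearCombination K fun i : s => F i).exists_leftInverse_of_injective
      (LinearMap.ker_eq_bot.2 h)
    let φ : (n → K) →ₗ[K] K := Finsupp.linearCombination K (fun i : s => ℓ i) ∘ₗ g
    have hφ (i : ι) (hi : i ∈ s) : φ (F i) = ℓ i := by
      have := LinearMap.congr_fun hg (Finsupp.single ⟨i, hi⟩ 1)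
      simp only [LinearMap.comp_apply, Finsupp.linearCombination_single, one_smul,
        LinearMap.id_apply] at this
      simp [φ, this]
    refine ⟨fun j => φ fun k => if j = k then 1 else 0, fun i hi => ?_⟩
    rw [← hφ i hi, φ.pi_apply_eq_sum_univ (F i)]
    rfl
  · intro h
    refine linearIndependent_iff'.2 fun t g hg i hi => ?_
    obtain ⟨u, hu⟩ := h (Pi.single i 1)
    have hzero : ∑ j ∈ t, g j * (F j ⬝ᵥ u) = 0 := by
      simpa [sum_dotProduct] using congrArg (· ⬝ᵥ u) hg
    rw [Finset.sum_eq_single i] at hzero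
    · simpa [hu i i.2] using hzero
    · intro j _ hji
      simp [hu j j.2, Subtype.coe_injective.ne hji]
    · exact fun hi' => absurd hi hi'

end DotProduct

theorem linearIndepOn_of_eq_smul {K ι E : Type*} [Field K] [AddCommGroup E] [Module K E]
    {F F' : ι → E} {s : Set ι} (h : LinearIndepOn K F s)
    (hF : ∀ i ∈ s, ∃ c : K, c ≠ 0 ∧ F' i = c • F i) : LinearIndepOn K F' s := by
  choose c hc hF using fun i : s => hF i i.2
  rw [LinearIndepOn, funext hF]
  exact LinearIndependent.units_smul h fun i => Units.mk0 (c i) (hc i)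

theorem eventually_linearIndepOn {T ι E : Type*} [TopologicalSpace T] [NormedAddCommGroup E]
    [NormedSpace ℝ E] {s : Set ι} [Finite s] {F : T → ι → E} {t₀ : T}
    (hF : ∀ i ∈ s, ContinuousAt (fun t => F t i) t₀) (h : LinearIndepOn ℝ (F t₀) s) :
    ∀ᶠ t in 𝓝 t₀, LinearIndepOn ℝ (F t) s := by
  have hcont : ContinuousAt (fun t (i : s) => F t i) t₀ := continuousAt_pi.2 fun i => hF i i.2
  exact hcont.eventually (LinearIndependent.eventually h)

section Independence

variable {V : Type*} {d : ℕ} {q : ℝ≥0∞} {G H : SimpleGraph V}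
  {p p' : V → PiLp q (fun _ : Fin d => ℝ)}

/-- The vector `(p_a - p_b)^{(q-1)}`. -/
noncomputable def edgeDir (q : ℝ≥0∞) (p : V → PiLp q (fun _ : Fin d => ℝ)) (a b : V) : Fin d → ℝ :=
  fun k => signedPow (q.toReal - 1) (p a k - p b k)

theorem edgeDir_swap (a b : V) : edgeDir q p b a = -edgeDir q p a b := by
  ext k
  simp [edgeDir, ← signedPow_neg]

theorem edgeDir_dotProduct_swap (a b : V) (x y : Fin d → ℝ) :
    edgeDir q p b a ⬝ᵥ (y - x) = edgeDir q p a b ⬝ᵥ (x - y) := by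
  rw [edgeDir_swap, neg_dotProduct, ← dotProduct_neg, neg_sub]

variable [DecidableEq V]

/-- The row of the rigidity matrix belonging to a pair of vertices, which need not be an edge. -/
noncomputable def rigidityRow (q : ℝ≥0∞) (p : V → PiLp q (fun _ : Fin d => ℝ)) (e : Sym2 V) :
    V × Fin d → ℝ :=
  fun c => rigidityEntry q p e c.1 c.2

/-- The framework `(G, p)` is independent: the rows of its rigidity matrix are. -/
def IsIndependent (q : ℝ≥0∞) (G : SimpleGraph V) (p : V → PiLp q (fun _ : Fin d => ℝ)) : Prop :=
  LinearIndepOn ℝ (rigidityRow q p) G.edgeSet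

theorem rigidityRow_mk (a b : V) (c : V × Fin d) :
    rigidityRow q p s(a, b) c =
      (if c.1 = a then edgeDir q p a b c.2 else 0) - if c.1 = b then edgeDir q p a b c.2 else 0 :=
  rfl

theorem rigidityRow_eq_smul {a b : V} {r : ℝ} (h : edgeDir q p' a b = r • edgeDir q p a b) :
    rigidityRow q p' s(a, b) = r • rigidityRow q p s(a, b) := by
  ext c
  simp only [rigidityRow_mk, h, Pi.smul_apply, smul_eq_mul]
  split_ifs <;> ring

theorem rigidityRow_dotProduct [Fintype V] (a b : V) (u : V × Fin d → ℝ) :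
    rigidityRow q p s(a, b) ⬝ᵥ u =
      edgeDir q p a b ⬝ᵥ (Function.curry u a - Function.curry u b) := by
  simp only [dotProduct, rigidityRow_mk, Fintype.sum_prod_type_right, sub_mul, ite_mul, zero_mul,
    Finset.sum_sub_distrib, Finset.sum_ite_eq', Finset.mem_univ, if_true, Pi.sub_apply, mul_sub,
    Function.curry_apply]

theorem isIndependent_iff [Finite V] :
    IsIndependent q G p ↔ ∀ ℓ : Sym2 V → ℝ, ∃ u : V → Fin d → ℝ, ∀ a b, G.Adj a b →
      edgeDir q p a b ⬝ᵥ (u a - u b) = ℓ s(a, b) := by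
  have := Fintype.ofFinite V
  refine linearIndepOn_iff_forall_exists_dotProduct_eq.trans (forall_congr' fun ℓ => ?_)
  constructor
  · rintro ⟨u, hu⟩
    exact ⟨Function.curry u, fun a b hab => (rigidityRow_dotProduct a b u).symm.trans (hu _ hab)⟩
  · rintro ⟨u, hu⟩
    refine ⟨Function.uncurry u, Sym2.ind fun a b hab => ?_⟩
    rw [rigidityRow_dotProduct, Function.curry_uncurry]
    exact hu a b hab

theorem IsIndependent.mono (h : IsIndependent q G p) (hH : H ≤ G) : IsIndependent q H p :=
  LinearIndepOn.mono h (SimpleGraph.edgeSet_mono hH)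

theorem IsIndependent.ne_of_adj (h : IsIndependent q G p) {a b : V}
    (hab : G.Adj a b) : p a ≠ p b := by
  intro heq
  refine h.ne_zero (G.mem_edgeSet.2 hab) (funext fun c => ?_)
  simp [rigidityRow_mk, edgeDir, heq]

theorem IsIndependent.congr (h : IsIndependent q G p) (hp : ∀ a ∈ G.support, p' a = p a) :
    IsIndependent q G p' := by
  refine (linearIndepOn_congr ?_).1 h
  refine fun e => Sym2.ind (fun a b (hab : G.Adj a b) => funext fun c => ?_) e
  simp only [rigidityRow_mk, edgeDir, hp a ⟨b, hab⟩, hp b ⟨a, hab.symm⟩]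

theorem continuous_rigidityRow (hq : 1 < q.toReal) {T : Type*} [TopologicalSpace T]
    {P : T → V → PiLp q (fun _ : Fin d => ℝ)} (hP : ∀ a k, Continuous fun t => P t a k)
    (e : Sym2 V) :
    Continuous fun t => rigidityRow q (P t) e := by
  induction e with | _ a b
  have hdir (k) : Continuous fun t => edgeDir q (P t) a b k :=
    (continuous_signedPow (by linarith)).comp ((hP a k).sub (hP b k))
  refine continuous_pi fun c => ?_
  simp only [rigidityRow_mk]
  split_ifs <;> fun_prop

theorem IsIndependent.eventually [Finite V] (hq : 1 < q.toReal) {T : Type*} [TopologicalSpace T]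
    {P : T → V → PiLp q (fun _ : Fin d => ℝ)} {t₀ : T} (hP : ∀ a k, Continuous fun t => P t a k)
    (h : IsIndependent q G (P t₀)) : ∀ᶠ t in 𝓝 t₀, IsIndependent q G (P t) := by
  have := Fintype.ofFinite V
  exact eventually_linearIndepOn (fun e _ => (continuous_rigidityRow hq hP e).continuousAt) h

end Independence

section Moves

variable {V : Type*} {d : ℕ} {q : ℝ≥0∞} {G H : SimpleGraph V}
  {p : V → PiLp q (fun _ : Fin d => ℝ)} {v a b c : V}

theorem exists_stretch_eq_of_deleteIncidenceSet (v : V) {ℓ : Sym2 V → ℝ} {u : V → Fin d → ℝ}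
    {w : Fin d → ℝ}
    (hu : ∀ x y, (G.deleteIncidenceSet v).Adj x y → edgeDir q p x y ⬝ᵥ (u x - u y) = ℓ s(x, y))
    (hw : ∀ x, G.Adj v x → edgeDir q p v x ⬝ᵥ (w - u x) = ℓ s(v, x)) :
    ∃ u' : V → Fin d → ℝ, ∀ x y, G.Adj x y → edgeDir q p x y ⬝ᵥ (u' x - u' y) = ℓ s(x, y) := by
  classical
  refine ⟨Function.update u v w, fun x y hxy => ?_⟩
  rcases eq_or_ne x v with rfl | hx
  · simpa [hxy.ne'] using hw y hxy
  rcases eq_or_ne y v with rfl | hy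
  · rw [← edgeDir_dotProduct_swap, Sym2.eq_swap]
    simpa [hxy.ne] using hw x hxy.symm
  · simpa [hx, hy] using hu x y (SimpleGraph.deleteIncidenceSet_adj.2 ⟨hxy, hx, hy⟩)

variable [Finite V] [DecidableEq V]

theorem IsIndependent.of_deleteIncidenceSet (h : IsIndependent q (G.deleteIncidenceSet v) p)
    (hv : LinearIndepOn ℝ (edgeDir q p v) (G.neighborSet v)) : IsIndependent q G p := by
  refine isIndependent_iff.2 fun ℓ => ?_
  obtain ⟨u, hu⟩ := isIndependent_iff.1 h ℓ
  obtain ⟨w, hw⟩ := linearIndepOn_iff_forall_exists_dotProduct_eq.1 hv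
    fun x => ℓ s(v, x) + edgeDir q p v x ⬝ᵥ u x
  exact exists_stretch_eq_of_deleteIncidenceSet v hu fun x hvx => by
    rw [dotProduct_sub, hw x hvx, add_sub_cancel_right]

/-- With `v` at the midpoint, the directions of `va` and `vb` are opposite multiples of the one of
`ab`, so that the sum of the stretches of `va` and `vb` is a multiple of the stretch of `ab`. -/
theorem IsIndependent.of_subdivision {S : Set V}
    (h : IsIndependent q (G.deleteIncidenceSet v ⊔ SimpleGraph.edge a b) p)
    (hN : G.neighborSet v = insert b S) (ha : a ∈ S) (hab : a ≠ b) (hG : ¬ G.Adj a b)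
    (hmid : ∀ k, p v k = (p a k + p b k) / 2) (hS : LinearIndepOn ℝ (edgeDir q p v) S) :
    IsIndependent q G p := by
  set c := signedPow (q.toReal - 1) (1 / 2)
  have hc : c ≠ 0 := signedPow_eq_zero_iff.not.2 (by norm_num)
  have dir_va : edgeDir q p v a = -(c • edgeDir q p a b) := by
    ext k
    simp only [edgeDir, Pi.neg_apply, Pi.smul_apply, smul_eq_mul, c, ← signedPow_mul,
      ← signedPow_neg, hmid]
    ring_nf
  have dir_vb : edgeDir q p v b = c • edgeDir q p a b := by
    ext k
    simp only [edgeDir, Pi.smul_apply, smul_eq_mul, c, ← signedPow_mul, hmid]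
    ring_nf
  refine isIndependent_iff.2 fun ℓ => ?_
  obtain ⟨u, hu⟩ := isIndependent_iff.1 h
    (Function.update ℓ s(a, b) (c⁻¹ * (ℓ s(v, a) + ℓ s(v, b))))
  obtain ⟨w, hw⟩ := linearIndepOn_iff_forall_exists_dotProduct_eq.1 hS
    fun x => ℓ s(v, x) + edgeDir q p v x ⬝ᵥ u x
  have stretch_ab := hu a b (Or.inr (by simp [SimpleGraph.edge_adj, hab]))
  rw [Function.update_self, eq_inv_mul_iff_mul_eq₀ hc, dotProduct_sub] at stretch_ab
  refine exists_stretch_eq_of_deleteIncidenceSet v (u := u) (w := w) (fun x y hxy => ?_)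
    fun x hvx => ?_
  · have hne : s(x, y) ≠ s(a, b) := fun heq =>
      hG ((SimpleGraph.adj_congr_of_sym2 G heq).1 (G.deleteIncidenceSet_le v hxy))
    simpa [hne] using hu x y (Or.inl hxy)
  · have hx : x ∈ insert b S := hN ▸ hvx
    rcases hx with rfl | hx
    · have stretch_va := hw a ha
      rw [dir_va] at stretch_va
      rw [dir_vb, dotProduct_sub]
      simp only [neg_dotProduct, smul_dotProduct, smul_eq_mul] at stretch_va ⊢
      linear_combination stretch_ab - stretch_va
    · rw [dotProduct_sub, hw x hx, add_sub_cancel_right]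

/-- Prescribe the stretches inside the fibres of `π` first; those of the remaining edges are then
corrected by velocities that are constant on the fibres. -/
theorem linearIndepOn_ite_isDiag_map {W : Type*} [Finite W] [DecidableEq W] {π : V → W}
    {p₁ : V → PiLp q (fun _ : Fin d => ℝ)} {p₂ : W → PiLp q (fun _ : Fin d => ℝ)}
    (hH : ∀ x y, G.Adj x y → π x = π y → H.Adj x y)
    (hinj : Set.InjOn (Sym2.map π) {e ∈ G.edgeSet | ¬ (e.map π).IsDiag})
    (h₁ : IsIndependent q H p₁) (h₂ : IsIndependent q (G.map π) p₂) :
    LinearIndepOn ℝ (fun e => if (e.map π).IsDiag then rigidityRow q p₁ e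
      else rigidityRow q (p₂ ∘ π) e) G.edgeSet := by
  have := Fintype.ofFinite V
  refine linearIndepOn_iff_forall_exists_dotProduct_eq.2 fun ℓ => ?_
  obtain ⟨u₁, hu₁⟩ := isIndependent_iff.1 h₁ ℓ
  let rest (e : Sym2 V) : ℝ := ℓ e - rigidityRow q (p₂ ∘ π) e ⬝ᵥ Function.uncurry u₁
  obtain ⟨g, hg⟩ : ∃ g : Sym2 W → ℝ, ∀ e ∈ G.edgeSet, ¬ (e.map π).IsDiag → g (e.map π) = rest e :=
    ⟨Function.extend (Set.domRestrict _ (Sym2.map π)) (fun e => rest e) 0, fun e he hπ =>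
      (Set.injOn_iff_injective.1 hinj).extend_apply (fun e => rest e) 0 ⟨e, he, hπ⟩⟩
  obtain ⟨u₂, hu₂⟩ := isIndependent_iff.1 h₂ g
  refine ⟨Function.uncurry fun x => u₂ (π x) + u₁ x, Sym2.ind fun x y hxy => ?_⟩
  simp only [Sym2.map_mk, Sym2.mk_isDiag_iff]
  split_ifs with hπ
  · rw [rigidityRow_dotProduct, Function.curry_uncurry, hπ, add_sub_add_left_eq_sub]
    exact hu₁ x y (hH x y hxy hπ)
  · have stretch := hu₂ (π x) (π y) (SimpleGraph.map_adj_apply' hxy hπ)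
    rw [← Sym2.map_mk, hg _ hxy (by simpa using hπ)] at stretch
    rw [rigidityRow_dotProduct, Function.curry_uncurry, add_sub_add_comm, dotProduct_add]
    simp only [rest, rigidityRow_dotProduct, Function.curry_uncurry] at stretch
    exact eq_sub_iff_add_eq.1 stretch

/-- Scaling `p₁` down by `t` within the fibres only rescales their rows, and as `t → 0`
the rows of the other edges tend to those of `p₂ ∘ π`. -/
theorem exists_isIndependent_of_map (hq : 1 < q.toReal) {W : Type*} [Finite W] [DecidableEq W]
    {π : V → W} {p₁ : V → PiLp q (fun _ : Fin d => ℝ)} {p₂ : W → PiLp q (fun _ : Fin d => ℝ)}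
    (hH : ∀ x y, G.Adj x y → π x = π y → H.Adj x y)
    (hinj : Set.InjOn (Sym2.map π) {e ∈ G.edgeSet | ¬ (e.map π).IsDiag})
    (h₁ : IsIndependent q H p₁) (h₂ : IsIndependent q (G.map π) p₂) :
    ∃ p : V → PiLp q (fun _ : Fin d => ℝ), IsIndependent q G p := by
  have := Fintype.ofFinite V
  let P (t : ℝ) (x : V) : PiLp q (fun _ : Fin d => ℝ) := p₂ (π x) + t • p₁ x
  have hP (x k) : Continuous fun t => P t x k := by
    simp only [P, PiLp.add_apply, PiLp.smul_apply]
    fun_prop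
  have hP0 : P 0 = p₂ ∘ π := by ext; simp [P]
  let F (t : ℝ) (e : Sym2 V) : V × Fin d → ℝ :=
    if (e.map π).IsDiag then rigidityRow q p₁ e else rigidityRow q (P t) e
  have hF : ∀ᶠ t in 𝓝 0, LinearIndepOn ℝ (F t) G.edgeSet := by
    refine eventually_linearIndepOn (fun e _ => ?_)
      (by simpa only [F, hP0] using linearIndepOn_ite_isDiag_map hH hinj h₁ h₂)
    by_cases he : (e.map π).IsDiag
    · simpa only [F, he, if_true] using continuousAt_const
    · simpa only [F, he, if_false] using (continuous_rigidityRow hq hP e).continuousAt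
  obtain ⟨t, ht, ht0⟩ := ((hF.filter_mono nhdsWithin_le_nhds).and
    (self_mem_nhdsWithin (s := {0}ᶜ))).exists
  refine ⟨P t, linearIndepOn_of_eq_smul ht fun e _ => ?_⟩
  by_cases he : (e.map π).IsDiag
  · refine ⟨signedPow (q.toReal - 1) t, signedPow_eq_zero_iff.not.2 ht0, ?_⟩
    induction e with | _ x y
    have hπ : π x = π y := by simpa using he
    simp only [F, he, if_true]
    refine rigidityRow_eq_smul (funext fun k => ?_)
    simp only [edgeDir, P, hπ, PiLp.add_apply, PiLp.smul_apply, smul_eq_mul,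
      add_sub_add_left_eq_sub, ← mul_sub, signedPow_mul, Pi.smul_apply]
  · exact ⟨1, one_ne_zero, by simp only [F, he, if_false, one_smul]⟩

theorem IsIndependent.exists_update (hq : 1 < q.toReal) (h : IsIndependent q G p) (a : V)
    (w : PiLp q (fun _ : Fin d => ℝ)) :
    ∃ t : ℝ, t ≠ 0 ∧ IsIndependent q G (Function.update p a (p a + t • w)) := by
  let P (t : ℝ) : V → PiLp q (fun _ : Fin d => ℝ) := Function.update p a (p a + t • w)
  have hP (x k) : Continuous fun t => P t x k := by
    rcases eq_or_ne x a with rfl | hx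
    · simp only [P, Function.update_self, PiLp.add_apply, PiLp.smul_apply]
      fun_prop
    · simp only [P, Function.update_of_ne hx]
      fun_prop
  have hP0 : IsIndependent q G (P 0) := by simpa [P] using h
  exact (((hP0.eventually hq hP).filter_mono nhdsWithin_le_nhds).and
    (self_mem_nhdsWithin (s := {0}ᶜ))).exists.imp fun t ht => ⟨ht.2, ht.1⟩

end Moves

section Plane

variable {V : Type*} {q : ℝ≥0∞} {G : SimpleGraph V}
  {p : V → PiLp q (fun _ : Fin 2 => ℝ)} {v a b c : V}

/-- Twice the signed area of the triangle with vertices `x`, `y`, `z`. -/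
def signedArea (x y z : PiLp q (fun _ : Fin 2 => ℝ)) : ℝ :=
  (x 0 - z 0) * (y 1 - z 1) - (x 1 - z 1) * (y 0 - z 0)

/-- Signed powers are multiplicative and injective, so they preserve the non-vanishing of
`2 × 2` minors. -/
theorem linearIndepOn_edgeDir_pair (hq : 1 < q.toReal) (hab : a ≠ b)
    (h : signedArea (p a) (p b) (p v) ≠ 0) : LinearIndepOn ℝ (edgeDir q p v) {a, b} := by
  set x := edgeDir q p v a with hx
  set y := edgeDir q p v b with hy
  have minor_ne : x 0 * y 1 - x 1 * y 0 ≠ 0 := by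
    simp only [hx, hy, edgeDir, ← signedPow_mul]
    rw [sub_ne_zero, (signedPow_injective (by linarith)).ne_iff]
    contrapose! h
    rw [signedArea]
    linear_combination h
  refine (LinearIndepOn.pair_iff _ hab).2 fun s t hst => ?_
  rw [← hx, ← hy] at hst
  have h0 : s * x 0 + t * y 0 = 0 := congrFun hst 0
  have h1 : s * x 1 + t * y 1 = 0 := congrFun hst 1
  constructor
  · exact (mul_eq_zero.1 (by linear_combination y 1 * h0 - y 0 * h1 :
      s * (x 0 * y 1 - x 1 * y 0) = 0)).resolve_right minor_ne
  · exact (mul_eq_zero.1 (by linear_combination x 0 * h1 - x 1 * h0 :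
      t * (x 0 * y 1 - x 1 * y 0) = 0)).resolve_right minor_ne

variable [DecidableEq V] [Finite V]

theorem IsIndependent.exists_ne (hq : 1 < q.toReal) (h : IsIndependent q G p) (hab : a ≠ b) :
    ∃ p' : V → PiLp q (fun _ : Fin 2 => ℝ), IsIndependent q G p' ∧ p' a ≠ p' b := by
  by_cases hne : p a = p b
  · obtain ⟨t, ht, h'⟩ := h.exists_update hq a (WithLp.toLp q ![1, 0])
    refine ⟨_, h', fun heq => ht ?_⟩
    simpa [hab.symm, hne] using congrArg (fun x => x 0) heq
  · exact ⟨p, h, hne⟩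

theorem IsIndependent.exists_signedArea_ne_zero (hq : 1 < q.toReal) (h : IsIndependent q G p)
    (hab : a ≠ b) (hac : a ≠ c) (hbc : b ≠ c) :
    ∃ p' : V → PiLp q (fun _ : Fin 2 => ℝ),
      IsIndependent q G p' ∧ signedArea (p' a) (p' b) (p' c) ≠ 0 := by
  obtain ⟨p, h, hne⟩ := h.exists_ne hq hab
  by_cases harea : signedArea (p a) (p b) (p c) = 0
  · obtain ⟨t, ht, h'⟩ := h.exists_update hq c (WithLp.toLp q ![p b 1 - p a 1, p a 0 - p b 0])
    refine ⟨_, h', fun hzero => hne ?_⟩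
    simp only [signedArea, Function.update_of_ne hac, Function.update_of_ne hbc,
      Function.update_self, PiLp.add_apply, PiLp.smul_apply, smul_eq_mul, Matrix.cons_val_zero,
      Matrix.cons_val_one] at hzero harea
    have hdist : (p a 0 - p b 0) ^ 2 + (p a 1 - p b 1) ^ 2 = 0 :=
      (mul_eq_zero.1 (by linear_combination harea - hzero :
        t * ((p a 0 - p b 0) ^ 2 + (p a 1 - p b 1) ^ 2) = 0)).resolve_left ht
    ext k
    fin_cases k
    · simp; nlinarith
    · simp; nlinarith
  · exact ⟨p, h, harea⟩

theorem exists_isIndependent_of_ncard_neighborSet_le_two (hq : 1 < q.toReal)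
    (h : IsIndependent q (G.deleteIncidenceSet v) p) (hv : (G.neighborSet v).ncard ≤ 2) :
    ∃ p' : V → PiLp q (fun _ : Fin 2 => ℝ), IsIndependent q G p' := by
  have ne_of_mem {x : V} (hx : x ∈ G.neighborSet v) : v ≠ x := SimpleGraph.Adj.ne hx
  interval_cases hcard : (G.neighborSet v).ncard
  · have hN := (Set.ncard_eq_zero).1 hcard
    exact ⟨p, h.of_deleteIncidenceSet (hN ▸ linearIndepOn_empty ℝ _)⟩
  · obtain ⟨a, hN⟩ := Set.ncard_eq_one.1 hcard
    have hva : v ≠ a := ne_of_mem (hN ▸ rfl)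
    obtain ⟨p', h', hne⟩ := h.exists_ne hq hva
    refine ⟨p', h'.of_deleteIncidenceSet ?_⟩
    rw [hN, linearIndepOn_singleton_iff]
    contrapose! hne
    ext k
    simpa [edgeDir, signedPow_eq_zero_iff, sub_eq_zero] using congrFun hne k
  · obtain ⟨a, b, hab, hN⟩ := Set.ncard_eq_two.1 hcard
    have hva : v ≠ a := ne_of_mem (by simp [hN])
    have hvb : v ≠ b := ne_of_mem (by simp [hN])
    obtain ⟨p', h', harea⟩ := h.exists_signedArea_ne_zero hq hab hva.symm hvb.symm
    exact ⟨p', h'.of_deleteIncidenceSet (hN ▸ linearIndepOn_edgeDir_pair hq hab harea)⟩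

theorem exists_isIndependent_of_subdivision (hq : 1 < q.toReal)
    (h : IsIndependent q (G.deleteIncidenceSet v ⊔ SimpleGraph.edge a b) p)
    (hN : G.neighborSet v = {a, b, c}) (hab : a ≠ b) (hac : a ≠ c) (hbc : b ≠ c)
    (hG : ¬ G.Adj a b) : ∃ p' : V → PiLp q (fun _ : Fin 2 => ℝ), IsIndependent q G p' := by
  have ne_of_mem {x : V} (hx : x ∈ G.neighborSet v) : x ≠ v := (SimpleGraph.Adj.ne hx).symm
  have ha : a ≠ v := ne_of_mem (by simp [hN])
  have hb : b ≠ v := ne_of_mem (by simp [hN])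
  have hc : c ≠ v := ne_of_mem (by simp [hN])
  obtain ⟨p₁, h₁, harea⟩ := h.exists_signedArea_ne_zero hq hab hac hbc
  let p₂ := Function.update p₁ v (WithLp.toLp q fun k => (p₁ a k + p₁ b k) / 2)
  have h₂ : IsIndependent q (G.deleteIncidenceSet v ⊔ SimpleGraph.edge a b) p₂ := by
    refine h₁.congr fun x ⟨y, hxy⟩ => Function.update_of_ne ?_ _ _
    rintro rfl
    simp [SimpleGraph.deleteIncidenceSet_adj, SimpleGraph.edge_adj, ha.symm, hb.symm] at hxy
  refine ⟨p₂, h₂.of_subdivision (S := {a, c}) ?_ (by simp) hab hG ?_ ?_⟩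
  · rw [hN, Set.insert_comm]
  · intro k
    simp [p₂, ha, hb]
  · refine linearIndepOn_edgeDir_pair hq hac ?_
    contrapose! harea
    simp only [signedArea, p₂, Function.update_self, Function.update_of_ne ha,
      Function.update_of_ne hc] at harea ⊢
    linear_combination (-2) * harea

/-- A placement of the four vertices of `K₄` that is dependent for `q = 2` only. -/
noncomputable def completeFourPlacement (q : ℝ≥0∞) : Fin 4 → PiLp q (fun _ : Fin 2 => ℝ) :=
  fun i => WithLp.toLp q (![![0, 0], ![1, 0], ![0, 1], ![1 / 2, 1]] i)

theorem isIndependent_top_completeFourPlacement (hq2 : q.toReal ≠ 2) :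
    IsIndependent q ⊤ (completeFourPlacement q) := by
  set X := signedPow (q.toReal - 1) (1 / 2) with hX
  have X_ne_zero : X ≠ 0 := signedPow_eq_zero_iff.not.2 (by norm_num)
  have signedPow_two_mul_X : signedPow (q.toReal - 1) 2 * X = 1 := by
    rw [hX, ← signedPow_mul, mul_one_div_cancel two_ne_zero, signedPow_one]
  have one_sub_ne_zero : 1 - 2 * X ≠ 0 := fun h =>
    signedPow_two_ne_two (r := q.toReal - 1) (fun h' => hq2 (by linarith))
      (mul_right_cancel₀ X_ne_zero (by linarith))
  refine isIndependent_iff.2 fun ℓ => ?_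
  obtain ⟨t, ht⟩ : ∃ t, t * (1 - 2 * X) = ℓ s(1, 3) - X * ℓ s(0, 1) + ℓ s(0, 1) + ℓ s(2, 3) / X +
      ℓ s(0, 2) - ℓ s(1, 2) - ℓ s(0, 3) := ⟨_, div_mul_cancel₀ _ one_sub_ne_zero⟩
  let u : Fin 4 → Fin 2 → ℝ :=
    ![![0, 0], ![ℓ s(0, 1), ℓ s(0, 1) - t + ℓ s(2, 3) / X + ℓ s(0, 2) - ℓ s(1, 2)],
      ![t - ℓ s(2, 3) / X, ℓ s(0, 2)], ![t, ℓ s(0, 3) - X * t]]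
  have hu (a b : Fin 4) (hab : a < b) :
      edgeDir q (completeFourPlacement q) a b ⬝ᵥ (u a - u b) = ℓ s(a, b) := by
    have signedPow_half : signedPow (q.toReal - 1) 2⁻¹ = X := by rw [hX, one_div]
    have signedPow_one_sub_half : signedPow (q.toReal - 1) (1 - 2⁻¹) = X := by rw [hX]; norm_num
    fin_cases a <;> fin_cases b <;> first | exact absurd hab (by decide) | skip
    all_goals simp only [u, edgeDir, completeFourPlacement, dotProduct, Fin.sum_univ_two,
      Fin.zero_eta, Fin.mk_one, Fin.reduceFinMk, Matrix.cons_val, Pi.sub_apply, sub_self, sub_zero,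
      zero_sub, one_div, signedPow_zero, signedPow_one, signedPow_neg, signedPow_half,
      signedPow_one_sub_half]
    · ring
    · ring
    · ring
    · ring
    · linear_combination ht
    · linear_combination mul_div_cancel₀ (ℓ s(2, 3)) X_ne_zero
  refine ⟨u, fun a b hab => ?_⟩
  rcases lt_or_gt_of_ne hab.ne with hlt | hlt
  · exact hu a b hlt
  · rw [← edgeDir_dotProduct_swap, Sym2.eq_swap, hu b a hlt]

theorem exists_isIndependent_of_ncard_support_eq_four (hq : 1 < q.toReal) (hq2 : q.toReal ≠ 2)
    (hG : G.support.ncard = 4) : ∃ p : V → PiLp q (fun _ : Fin 2 => ℝ), IsIndependent q G p := by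
  obtain ⟨φ, hφ⟩ : ∃ φ : V → Fin 4, Set.InjOn φ G.support := by
    have e : G.support ≃ Fin 4 := Finite.equivFinOfCardEq hG
    refine ⟨Function.extend Subtype.val e 0, Set.injOn_iff_injective.2 fun x y hxy => ?_⟩
    simpa [Set.domRestrict_apply, Subtype.val_injective.extend_apply] using hxy
  have ne_of_adj {x y : V} (hxy : G.Adj x y) : φ x ≠ φ y :=
    hφ.ne ⟨y, hxy⟩ ⟨x, hxy.symm⟩ hxy.ne
  refine exists_isIndependent_of_map (π := φ) (H := ⊥) (p₁ := 0) hq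
    (fun x y hxy h => ne_of_adj hxy h) ?_ ?_
    ((isIndependent_top_completeFourPlacement hq2).mono le_top)
  · rintro ⟨x, y⟩ ⟨hxy, -⟩ ⟨x', y'⟩ ⟨hxy', -⟩ h
    have mem_left {x y : V} (hxy : G.Adj x y) : x ∈ G.support := ⟨y, hxy⟩
    have hx := mem_left hxy
    have hy := mem_left hxy.symm
    have hx' := mem_left hxy'
    have hy' := mem_left hxy'.symm
    simpa only [Sym2.map_mk, Sym2.eq_iff, hφ.eq_iff hx hx', hφ.eq_iff hy hy', hφ.eq_iff hx hy',
      hφ.eq_iff hy hx'] using h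
  · simp [IsIndependent]

end Plane

section Counting

variable {V : Type*} {G H : SimpleGraph V} {X Y M : Set V} {v a b c m : V}

/-- The number of edges of `G` with both ends in `X`. -/
noncomputable def edgeCount (G : SimpleGraph V) (X : Set V) : ℕ := (G.edgeSet ∩ X.sym2).ncard

/-- The vertex set `X` spans at least `2|X| - 2` edges; in a `(2,2)`-sparse graph this is the
largest possible number. -/
def IsTight (G : SimpleGraph V) (X : Set V) : Prop := 2 * X.ncard ≤ edgeCount G X + 2

theorem edgeCount_eq_ncard_edgeSet (hX : G.support ⊆ X) : edgeCount G X = G.edgeSet.ncard := by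
  rw [edgeCount, Set.inter_eq_left.2 (SimpleGraph.edgeSet_subset_sym2_iff.2 hX)]

theorem edgeCount_inter (hY : G.support ⊆ Y) : edgeCount G (X ∩ Y) = edgeCount G X := by
  rw [edgeCount, edgeCount, Set.sym2_inter, Set.inter_comm X.sym2, ← Set.inter_assoc,
    Set.inter_eq_left.2 (SimpleGraph.edgeSet_subset_sym2_iff.2 hY)]

/-- The map that collapses the vertex set `M` to the point `m`. -/
noncomputable def collapse (M : Set V) (m : V) : V → V :=
  open Classical in fun x => if x ∈ M then m else x

theorem mem_of_collapse_mem (hmX : m ∉ X) (h : collapse M m v ∈ X) : v ∈ X := by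
  grind [collapse]

theorem mem_union_of_collapse_mem (h : collapse M m v ∈ X) : v ∈ X ∪ M := by
  grind [collapse]

variable [Finite V]

theorem edgeCount_mono (hG : G ≤ H) (X : Set V) : edgeCount G X ≤ edgeCount H X :=
  Set.ncard_le_ncard (Set.inter_subset_inter_left _ (SimpleGraph.edgeSet_mono hG))

theorem edgeCount_insert (hv : v ∉ X) :
    edgeCount G (insert v X) = edgeCount G X + (G.neighborSet v ∩ X).ncard := by
  have edges_insert : G.edgeSet ∩ (insert v X).sym2 =
      G.edgeSet ∩ X.sym2 ∪ (s(v, ·)) '' (G.neighborSet v ∩ X) := by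
    ext e
    induction e with | _ x y
    simp only [Set.mem_inter_iff, SimpleGraph.mem_edgeSet, Set.mk_mem_sym2_iff, Set.mem_insert_iff,
      Set.mem_union, Set.mem_image, SimpleGraph.mem_neighborSet, Sym2.eq_iff]
    grind [G.adj_comm, G.irrefl]
  rw [edgeCount, edges_insert, Set.ncard_union_eq, Set.ncard_image_of_injective]
  · rfl
  · exact fun x y h => Sym2.congr_right.1 h
  · rw [Set.disjoint_right]
    rintro _ ⟨x, -, rfl⟩ hx
    exact hv (Set.mk_mem_sym2_iff.1 hx.2).1

theorem isTwoTwoSparse_iff :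
    IsTwoTwoSparse G ↔ ∀ X : Set V, X.Nonempty → edgeCount G X + 2 ≤ 2 * X.ncard := by
  constructor
  · intro h X hX
    have edges_le : edgeCount G X ≤ ((⊤ : G.Subgraph).induce X).edgeSet.ncard := by
      refine Set.ncard_le_ncard fun e he => ?_
      induction e with | _ x y
      obtain ⟨hx, hy⟩ := Set.mk_mem_sym2_iff.1 he.2
      exact ⟨hx, hy, he.1⟩
    have hcount : _ ≤ 2 * (X.ncard : ℤ) - 2 := h ((⊤ : G.Subgraph).induce X) hX
    lia
  · intro h H hH
    have edges_le : H.edgeSet.ncard ≤ edgeCount G H.verts := by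
      refine Set.ncard_le_ncard fun e he => ⟨H.edgeSet_subset he, ?_⟩
      induction e with | _ x y
      exact Set.mk_mem_sym2_iff.2 ⟨H.edge_vert he, H.edge_vert (H.adj_symm he)⟩
    have hcount := h H.verts hH
    lia

theorem IsTwoTwoSparse.mono (h : IsTwoTwoSparse H) (hG : G ≤ H) : IsTwoTwoSparse G :=
  isTwoTwoSparse_iff.2 fun X hX =>
    (Nat.add_le_add_right (edgeCount_mono hG X) 2).trans (isTwoTwoSparse_iff.1 h X hX)

theorem IsTight.mono (h : IsTight G X) (hG : G ≤ H) : IsTight H X :=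
  h.trans (Nat.add_le_add_right (edgeCount_mono hG X) 2)

theorem IsTight.inter (h : IsTight G X) (hY : G.support ⊆ Y) : IsTight G (X ∩ Y) := by
  have := Set.ncard_le_ncard (Set.inter_subset_left : X ∩ Y ⊆ X)
  rw [IsTight, edgeCount_inter hY]
  exact (Nat.mul_le_mul_left 2 this).trans h

theorem IsTight.insert (h : IsTight G X) (hv : v ∉ X) (h2 : 2 ≤ (G.neighborSet v ∩ X).ncard) :
    IsTight G (insert v X) := by
  rw [IsTight, Set.ncard_insert_of_notMem hv, edgeCount_insert hv]
  rw [IsTight] at h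
  lia

theorem IsTwoTwoSparse.ncard_neighborSet_inter_le_two (h : IsTwoTwoSparse G) (hX : IsTight G X)
    (hv : v ∉ X) : (G.neighborSet v ∩ X).ncard ≤ 2 := by
  have hcount := isTwoTwoSparse_iff.1 h (insert v X) (Set.insert_nonempty v X)
  rw [edgeCount_insert hv, Set.ncard_insert_of_notMem hv] at hcount
  rw [IsTight] at hX
  lia

theorem IsTwoTwoSparse.exists_isTight (h : IsTwoTwoSparse G)
    (hab : ¬ IsTwoTwoSparse (G ⊔ SimpleGraph.edge a b)) : ∃ X, IsTight G X ∧ a ∈ X ∧ b ∈ X := by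
  rw [isTwoTwoSparse_iff] at h hab
  push Not at hab
  obtain ⟨X, hX, hcount⟩ := hab
  have edges_subset : (G ⊔ SimpleGraph.edge a b).edgeSet ⊆ insert s(a, b) G.edgeSet := by
    rw [SimpleGraph.edgeSet_sup, Set.union_comm]
    exact Set.union_subset_union_left _ SimpleGraph.edgeSet_edge_subset
  refine ⟨X, ?_, Set.mk_mem_sym2_iff.1 ?_⟩
  · have edgeCount_le : edgeCount (G ⊔ SimpleGraph.edge a b) X ≤ edgeCount G X + 1 :=
      (Set.ncard_le_ncard (t := insert s(a, b) (G.edgeSet ∩ X.sym2)) fun e he =>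
        (edges_subset he.1).imp_right fun heG => ⟨heG, he.2⟩).trans (Set.ncard_insert_le _ _)
    rw [IsTight]
    lia
  · by_contra hmem
    have edgeCount_le : edgeCount (G ⊔ SimpleGraph.edge a b) X ≤ edgeCount G X :=
      Set.ncard_le_ncard fun e he =>
        ⟨(edges_subset he.1).resolve_left fun heq => hmem (heq ▸ he.2), he.2⟩
    have := h X hX
    lia

theorem IsTwoTwoSparse.exists_ncard_neighborSet_le_three (h : IsTwoTwoSparse G)
    (hG : G.support.Nonempty) : ∃ v ∈ G.support, (G.neighborSet v).ncard ≤ 3 := by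
  classical
  have := Fintype.ofFinite V
  by_contra! hdeg
  have degree_sum : 4 * G.support.toFinset.card ≤ ∑ v ∈ G.support, G.degree v := by
    rw [mul_comm, ← smul_eq_mul]
    refine Finset.card_nsmul_le_sum _ _ _ fun v hv => ?_
    rw [← G.card_neighborSet_eq_degree, Set.fintypeCard_eq_ncard]
    exact hdeg v (Set.mem_toFinset.1 hv)
  have hcount := isTwoTwoSparse_iff.1 h G.support hG
  rw [edgeCount_eq_ncard_edgeSet subset_rfl, ← SimpleGraph.coe_edgeFinset, Set.ncard_coe_finset,
    Set.ncard_eq_toFinset_card'] at hcount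
  rw [G.sum_degrees_support_eq_twice_card_edges] at degree_sum
  lia

theorem isTight_of_isClique (hva : G.Adj v a) (hvb : G.Adj v b) (hvc : G.Adj v c)
    (hab : G.Adj a b) (hac : G.Adj a c) (hbc : G.Adj b c) : IsTight G {v, a, b, c} := by
  have va := hva.ne
  have vb := hvb.ne
  have vc := hvc.ne
  have ab := hab.ne
  have ac := hac.ne
  have bc := hbc.ne
  have hv : G.neighborSet v ∩ {a, b, c} = {a, b, c} := by grind [SimpleGraph.mem_neighborSet]
  have ha : G.neighborSet a ∩ {b, c} = {b, c} := by grind [SimpleGraph.mem_neighborSet]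
  have hb : G.neighborSet b ∩ {c} = {c} := by grind [SimpleGraph.mem_neighborSet]
  have hvertices : Set.ncard {v, a, b, c} = 4 := by simp_all
  rw [IsTight, edgeCount_insert (by simp_all), edgeCount_insert (by simp_all),
    edgeCount_insert (by simp_all), hv, ha, hb, hvertices, Set.ncard_pair bc,
    Set.ncard_eq_three.2 ⟨a, b, c, ab, ac, bc, rfl⟩, Set.ncard_singleton]
  lia

theorem edgeCount_map_collapse_le :
    edgeCount (G.map (collapse M m)) X ≤
      {e ∈ G.edgeSet | e.map (collapse M m) ∈ X.sym2 ∧ e ∉ M.sym2}.ncard := by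
  refine (Set.ncard_le_ncard ?_).trans (Set.ncard_image_le (f := Sym2.map (collapse M m)))
  rintro ⟨_, _⟩ ⟨⟨hne, x, y, hxy, rfl, rfl⟩, hX⟩
  refine ⟨s(x, y), ⟨hxy, hX, fun hM => hne ?_⟩, rfl⟩
  rw [Set.mk_mem_sym2_iff] at hM
  simp only [collapse, hM, if_true]

theorem IsTwoTwoSparse.map_collapse (h : IsTwoTwoSparse G) (hM : IsTight G M) (hm : m ∈ M) :
    IsTwoTwoSparse (G.map (collapse M m)) := by
  refine isTwoTwoSparse_iff.2 fun X hX => ?_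
  by_cases hmX : m ∈ X
  · have sym2_subset : M.sym2 ⊆ (X ∪ M).sym2 := by
      rw [← Set.inter_eq_left, ← Set.sym2_inter, Set.inter_eq_left.2 Set.subset_union_right]
    have hcount : edgeCount (G.map (collapse M m)) X + edgeCount G M ≤ edgeCount G (X ∪ M) := by
      rw [edgeCount.eq_def G (X ∪ M), ← Set.ncard_sdiff_add_ncard_of_subset
        (Set.inter_subset_inter_right _ sym2_subset)]
      refine Nat.add_le_add_right (edgeCount_map_collapse_le.trans (Set.ncard_le_ncard ?_)) _
      rintro ⟨x, y⟩ ⟨hxy, hX, hM⟩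
      obtain ⟨hx, hy⟩ := Set.mk_mem_sym2_iff.1 hX
      exact ⟨⟨hxy, Set.mk_mem_sym2_iff.2
        ⟨mem_union_of_collapse_mem hx, mem_union_of_collapse_mem hy⟩⟩, fun h => hM h.2⟩
    have vertices : (X ∪ M).ncard + 1 ≤ X.ncard + M.ncard := by
      rw [← Set.ncard_union_add_ncard_inter X M, Nat.add_le_add_iff_left, Nat.one_le_iff_ne_zero]
      exact Set.ncard_ne_zero_of_mem ⟨hmX, hm⟩
    have := isTwoTwoSparse_iff.1 h (X ∪ M) (hX.mono Set.subset_union_left)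
    rw [IsTight] at hM
    lia
  · refine (Nat.add_le_add_right ?_ 2).trans (isTwoTwoSparse_iff.1 h X hX)
    refine edgeCount_map_collapse_le.trans (Set.ncard_le_ncard ?_)
    rintro ⟨x, y⟩ ⟨hxy, hX, -⟩
    obtain ⟨hx, hy⟩ := Set.mk_mem_sym2_iff.1 hX
    exact ⟨hxy, Set.mk_mem_sym2_iff.2 ⟨mem_of_collapse_mem hmX hx, mem_of_collapse_mem hmX hy⟩⟩

end Counting

section Reduction

variable {V : Type*} {G : SimpleGraph V} {M : Set V} {v a b c m : V}

theorem support_deleteIncidenceSet_ssubset (hv : v ∈ G.support) :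
    (G.deleteIncidenceSet v).support ⊂ G.support :=
  (G.support_deleteIncidenceSet_subset v).trans_ssubset (Set.sdiff_singleton_ssubset.2 hv)

theorem support_deleteIncidenceSet_sup_edge_ssubset (hva : G.Adj v a) (hvb : G.Adj v b) :
    (G.deleteIncidenceSet v ⊔ SimpleGraph.edge a b).support ⊂ G.support := by
  have hv : v ∈ G.support := ⟨a, hva⟩
  refine Set.ssubset_of_subset_of_ssubset ?_ (Set.sdiff_singleton_ssubset.2 hv)
  rintro x ⟨y, hxy | hxy⟩
  · exact G.support_deleteIncidenceSet_subset v ⟨y, hxy⟩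
  · obtain ⟨⟨rfl, -⟩ | ⟨rfl, -⟩, -⟩ := (SimpleGraph.edge_adj ..).1 hxy
    exacts [⟨⟨v, hva.symm⟩, hva.ne'⟩, ⟨⟨v, hvb.symm⟩, hvb.ne'⟩]

theorem support_spanningCoe_induce_ssubset (hM : M ⊂ G.support) :
    (G.induce M).spanningCoe.support ⊂ G.support := by
  rw [SimpleGraph.support_spanningCoe]
  exact (Subtype.coe_image_subset M _).trans_ssubset hM

theorem support_map_collapse_ssubset (hM : M ⊆ G.support) (hnontrivial : M.Nontrivial)
    (hm : m ∈ M) : (G.map (collapse M m)).support ⊂ G.support := by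
  obtain ⟨x, hx, hxm⟩ := hnontrivial.exists_ne m
  refine Set.ssubset_of_subset_of_ssubset ?_ (Set.sdiff_singleton_ssubset.2 (hM hx))
  rintro _ ⟨_, -, y, z, hyz, rfl, rfl⟩
  have hy : y ∈ G.support := ⟨z, hyz⟩
  grind [collapse]

variable [Finite V]

/-- A vertex with two neighbours in a maximal proper tight set could be added to the set; the
result would be the whole support, so the vertex would have no further neighbours. -/
theorem IsTwoTwoSparse.exists_isTight_forall_subsingleton (h : IsTwoTwoSparse G)
    (hdeg : ∀ v ∈ G.support, 2 < (G.neighborSet v).ncard)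
    (hM : M ⊂ G.support) (hnontrivial : M.Nontrivial) (htight : IsTight G M) :
    ∃ M' ⊂ G.support, M'.Nontrivial ∧ IsTight G M' ∧
      ∀ y ∉ M', (G.neighborSet y ∩ M').Subsingleton := by
  obtain ⟨M', hMM', hmax⟩ := {X | X ⊂ G.support ∧ IsTight G X}.toFinite.exists_le_maximal
    ⟨hM, htight⟩
  obtain ⟨hM', htight'⟩ := hmax.prop
  refine ⟨M', hM', hnontrivial.mono hMM', htight', fun y hy => ?_⟩
  by_contra hsub
  have two_le : 2 ≤ (G.neighborSet y ∩ M').ncard :=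
    Set.one_lt_ncard_iff_nontrivial.2 (Set.not_subsingleton_iff.1 hsub)
  obtain ⟨x, hyx, -⟩ := Set.nonempty_of_ncard_ne_zero (zero_lt_two.trans_le two_le).ne'
  have insert_subset : insert y M' ⊆ G.support := Set.insert_subset ⟨x, hyx⟩ hM'.subset
  have insert_eq : insert y M' = G.support := by
    by_contra hne
    exact hy (hmax.le_of_ge ⟨insert_subset.ssubset_of_ne hne, htight'.insert hy two_le⟩
      (Set.subset_insert y M') (Set.mem_insert y M'))
  have neighborSet_subset : G.neighborSet y ⊆ M' := fun z hyz =>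
    (insert_eq ▸ (⟨y, hyz.symm⟩ : z ∈ G.support) : z ∈ insert y M').resolve_left hyz.ne'
  have := h.ncard_neighborSet_inter_le_two htight' hy
  rw [Set.inter_eq_left.2 neighborSet_subset] at this
  exact (hdeg y ⟨x, hyx⟩).not_ge this

theorem IsTwoTwoSparse.deleteIncidenceSet_sup_edge (h : IsTwoTwoSparse G)
    (htight : ∀ M ⊂ G.support, M.Nontrivial → ¬ IsTight G M) (hva : G.Adj v a) (hvb : G.Adj v b)
    (hab : a ≠ b) : IsTwoTwoSparse (G.deleteIncidenceSet v ⊔ SimpleGraph.edge a b) := by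
  by_contra hsparse
  have hle := G.deleteIncidenceSet_le v
  obtain ⟨X, hX, ha, hb⟩ := (h.mono hle).exists_isTight hsparse
  refine htight (X ∩ (G.support \ {v})) ?_ ?_
    ((hX.inter (G.support_deleteIncidenceSet_subset v)).mono hle)
  · exact ⟨fun x hx => hx.2.1, fun hsub => (hsub ⟨a, hva⟩).2.2 rfl⟩
  · exact ⟨a, ⟨ha, ⟨v, hva.symm⟩, hva.ne'⟩, b, ⟨hb, ⟨v, hvb.symm⟩, hvb.ne'⟩, hab⟩

theorem IsTwoTwoSparse.ncard_support_eq_four_or_exists_subdivision (h : IsTwoTwoSparse G)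
    (hG : G.support.Nonempty) (hdeg : ∀ v ∈ G.support, 2 < (G.neighborSet v).ncard)
    (htight : ∀ M ⊂ G.support, M.Nontrivial → ¬ IsTight G M) :
    G.support.ncard = 4 ∨ ∃ v a b c, G.neighborSet v = {a, b, c} ∧ a ≠ b ∧ a ≠ c ∧ b ≠ c ∧
      ¬ G.Adj a b ∧ IsTwoTwoSparse (G.deleteIncidenceSet v ⊔ SimpleGraph.edge a b) := by
  obtain ⟨v, hv, hcard⟩ := h.exists_ncard_neighborSet_le_three hG
  obtain ⟨a, b, c, hab, hac, hbc, hN⟩ := Set.ncard_eq_three.1 (hcard.antisymm (hdeg v hv))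
  have hva : G.Adj v a := (hN.symm ▸ by simp : a ∈ G.neighborSet v)
  have hvb : G.Adj v b := (hN.symm ▸ by simp : b ∈ G.neighborSet v)
  have hvc : G.Adj v c := (hN.symm ▸ by simp : c ∈ G.neighborSet v)
  by_cases adj_ab : G.Adj a b
  · by_cases adj_ac : G.Adj a c
    · by_cases adj_bc : G.Adj b c
      · left
        have clique_subset : {v, a, b, c} ⊆ G.support := by
          rintro x (rfl | rfl | rfl | rfl)
          exacts [⟨a, hva⟩, ⟨v, hva.symm⟩, ⟨v, hvb.symm⟩, ⟨v, hvc.symm⟩]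
        have hclique := isTight_of_isClique hva hvb hvc adj_ab adj_ac adj_bc
        have hnontrivial : Set.Nontrivial {v, a, b, c} := ⟨v, by simp, a, by simp, hva.ne⟩
        have clique_eq : {v, a, b, c} = G.support := by
          by_contra hne
          exact htight _ (clique_subset.ssubset_of_ne hne) hnontrivial hclique
        rw [← clique_eq]
        simp [hva.ne, hvb.ne, hvc.ne, hab, hac, hbc]
      · exact Or.inr ⟨v, b, c, a, by rw [hN]; grind, hbc, hab.symm, hac.symm, adj_bc,
          h.deleteIncidenceSet_sup_edge htight hvb hvc hbc⟩
    · exact Or.inr ⟨v, a, c, b, by rw [hN]; grind, hac, hab, hbc.symm, adj_ac,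
        h.deleteIncidenceSet_sup_edge htight hva hvc hac⟩
  · exact Or.inr ⟨v, a, b, c, hN, hab, hac, hbc, adj_ab,
      h.deleteIncidenceSet_sup_edge htight hva hvb hab⟩

variable [DecidableEq V] {q : ℝ≥0∞} {p₁ p₂ : V → PiLp q (fun _ : Fin 2 => ℝ)}

theorem exists_isIndependent_of_collapse (hq : 1 < q.toReal) (hm : m ∈ M)
    (hM : ∀ y ∉ M, (G.neighborSet y ∩ M).Subsingleton)
    (h₁ : IsIndependent q (G.induce M).spanningCoe p₁)
    (h₂ : IsIndependent q (G.map (collapse M m)) p₂) :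
    ∃ p : V → PiLp q (fun _ : Fin 2 => ℝ), IsIndependent q G p := by
  refine exists_isIndependent_of_map hq ?_ ?_ h₁ h₂
  · intro x y hxy hπ
    have : x ∈ M ∧ y ∈ M := by grind [collapse, G.irrefl]
    simp [this, hxy]
  · have eq_of_adj {x x' y : V} (hy : y ∉ M) (hx : x ∈ M) (hx' : x' ∈ M) (h : G.Adj x y)
        (h' : G.Adj x' y) : x = x' := hM y hy ⟨h.symm, hx⟩ ⟨h'.symm, hx'⟩
    rintro ⟨x, y⟩ ⟨hxy, hdiag⟩ ⟨x', y'⟩ ⟨hxy', hdiag'⟩ heq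
    simp only [Sym2.map_mk, Sym2.eq_iff, Sym2.mk_isDiag_iff, SimpleGraph.mem_edgeSet] at *
    grind [collapse, G.adj_comm]

theorem IsTwoTwoSparse.exists_isIndependent (hq : 1 < q.toReal) (hq2 : q.toReal ≠ 2)
    (h : IsTwoTwoSparse G) : ∃ p : V → PiLp q (fun _ : Fin 2 => ℝ), IsIndependent q G p := by
  induction hn : G.support.ncard using Nat.strong_induction_on generalizing G with
  | _ n ih
  replace ih {H : SimpleGraph V} (hlt : H.support ⊂ G.support) (hH : IsTwoTwoSparse H) :=
    ih _ (hn ▸ Set.ncard_lt_ncard hlt) hH rfl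
  rcases G.support.eq_empty_or_nonempty with hempty | hne
  · refine ⟨0, ?_⟩
    rw [G.support_eq_bot_iff.1 hempty]
    simp [IsIndependent]
  by_cases hdeg : ∃ v ∈ G.support, (G.neighborSet v).ncard ≤ 2
  · obtain ⟨v, hv, hcard⟩ := hdeg
    obtain ⟨p, hp⟩ := ih (support_deleteIncidenceSet_ssubset hv)
      (h.mono (G.deleteIncidenceSet_le v))
    exact exists_isIndependent_of_ncard_neighborSet_le_two hq hp hcard
  push Not at hdeg
  by_cases htight : ∃ M ⊂ G.support, M.Nontrivial ∧ IsTight G M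
  · obtain ⟨M, hM, hnontrivial, htight⟩ := htight
    obtain ⟨M, hM, hnontrivial, htight, hsub⟩ :=
      h.exists_isTight_forall_subsingleton hdeg hM hnontrivial htight
    obtain ⟨m, hm⟩ := hnontrivial.nonempty
    obtain ⟨p₁, h₁⟩ := ih (support_spanningCoe_induce_ssubset hM)
      (h.mono (G.spanningCoe_induce_le M))
    obtain ⟨p₂, h₂⟩ := ih (support_map_collapse_ssubset hM.subset hnontrivial hm)
      (h.map_collapse htight hm)
    exact exists_isIndependent_of_collapse hq hm hsub h₁ h₂
  push Not at htight
  obtain hfour | ⟨v, a, b, c, hN, hab, hac, hbc, hG, hsparse⟩ :=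
    h.ncard_support_eq_four_or_exists_subdivision hne hdeg htight
  · exact exists_isIndependent_of_ncard_support_eq_four hq hq2 hfour
  · have hva : G.Adj v a := (hN.symm ▸ by simp : a ∈ G.neighborSet v)
    have hvb : G.Adj v b := (hN.symm ▸ by simp : b ∈ G.neighborSet v)
    obtain ⟨p, hp⟩ := ih (support_deleteIncidenceSet_sup_edge_ssubset hva hvb) hsparse
    exact exists_isIndependent_of_subdivision hq hp hN hab hac hbc hG

end Reduction

section Rank

variable {V : Type*} [Fintype V] [DecidableEq V] {d : ℕ} {q : ℝ≥0∞} {G H : SimpleGraph V}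
  {p u : V → PiLp q (fun _ : Fin d => ℝ)}

theorem isIndependent_iff_rank_eq :
    IsIndependent q G p ↔ (rigidityMatrix q G p).rank = G.edgeSet.ncard := by
  have := Fintype.ofFinite G.edgeSet
  rw [← Set.fintypeCard_eq_ncard, (rigidityMatrix q G p).rank_eq_finrank_span_row, eq_comm]
  exact linearIndependent_iff_card_eq_finrank_span

theorem rank_le_ncard_edgeSet : (rigidityMatrix q G p).rank ≤ G.edgeSet.ncard := by
  have := Fintype.ofFinite G.edgeSet
  rw [← Set.fintypeCard_eq_ncard]
  exact (rigidityMatrix q G p).rank_le_card_height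

/-- The coordinates of a family of points, in the order of the columns of the rigidity matrix. -/
def coordinates : (V → PiLp q (fun _ : Fin d => ℝ)) ≃ₗ[ℝ] V × Fin d → ℝ :=
  (LinearEquiv.piCongrRight fun _ => WithLp.linearEquiv q ℝ (Fin d → ℝ)).trans
    (LinearEquiv.curry ℝ ℝ V (Fin d)).symm

/-- The velocities that preserve all edge lengths to first order, edges of length zero excepted:
the kernel of the rigidity matrix. -/
noncomputable def flexSpace (q : ℝ≥0∞) (G : SimpleGraph V) (p : V → PiLp q (fun _ : Fin d => ℝ)) :
    Submodule ℝ (V → PiLp q (fun _ : Fin d => ℝ)) :=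
  LinearMap.ker ((rigidityMatrix q G p).mulVecLin ∘ₗ coordinates.toLinearMap)

theorem mem_flexSpace_iff_rigidityRow :
    u ∈ flexSpace q G p ↔ ∀ e ∈ G.edgeSet, rigidityRow q p e ⬝ᵥ coordinates u = 0 := by
  simp only [flexSpace, LinearMap.mem_ker, funext_iff, Subtype.forall]
  rfl

theorem mem_flexSpace_iff : u ∈ flexSpace q G p ↔
    ∀ a b, G.Adj a b → ∑ k, signedPow (q.toReal - 1) (p a k - p b k) * (u a k - u b k) = 0 := by
  rw [mem_flexSpace_iff_rigidityRow, Sym2.forall]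
  simp only [rigidityRow_dotProduct]
  rfl

theorem flexSpace_anti (h : H ≤ G) : flexSpace q G p ≤ flexSpace q H p := fun _ hu =>
  mem_flexSpace_iff.2 fun a b hab => mem_flexSpace_iff.1 hu a b (h hab)

theorem rank_add_finrank_flexSpace :
    (rigidityMatrix q G p).rank + Module.finrank ℝ (flexSpace q G p) = d * Fintype.card V := by
  have hrank := LinearMap.finrank_range_add_finrank_ker
    ((rigidityMatrix q G p).mulVecLin ∘ₗ (coordinates (q := q)).toLinearMap)
  rw [LinearMap.range_comp_of_range_eq_top _ coordinates.range, coordinates.finrank_eq,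
    Module.finrank_fintype_fun_eq_card, Fintype.card_prod, Fintype.card_fin, mul_comm] at hrank
  exact hrank

theorem IsIndependent.ncard_edgeSet_le_rank (h : IsIndependent q H p) (hH : H ≤ G) :
    H.edgeSet.ncard ≤ (rigidityMatrix q G p).rank := by
  have hfinrank := Submodule.finrank_mono (flexSpace_anti hH : flexSpace q G p ≤ flexSpace q H p)
  have hH := rank_add_finrank_flexSpace (q := q) (G := H) (p := p)
  have hG := rank_add_finrank_flexSpace (q := q) (G := G) (p := p)
  rw [isIndependent_iff_rank_eq.1 h] at hH
  lia

theorem rank_eq_of_flexSpace_eq (h : flexSpace q G p = flexSpace q H p) :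
    (rigidityMatrix q G p).rank = (rigidityMatrix q H p).rank := by
  have hG := rank_add_finrank_flexSpace (q := q) (G := G) (p := p)
  rw [h, ← rank_add_finrank_flexSpace (G := H)] at hG
  exact Nat.add_right_cancel hG

theorem exists_isIndependent_flexSpace_eq (q : ℝ≥0∞) (G : SimpleGraph V)
    (p : V → PiLp q (fun _ : Fin d => ℝ)) :
    ∃ H ≤ G, IsIndependent q H p ∧ flexSpace q G p = flexSpace q H p := by
  obtain ⟨B, hBG, -, hspan, hB⟩ := exists_linearIndepOn_extension
    (linearIndepOn_empty ℝ (rigidityRow q p)) (Set.empty_subset G.edgeSet)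
  have edgeSet_eq : (SimpleGraph.fromEdgeSet B).edgeSet = B := by
    rw [SimpleGraph.edgeSet_fromEdgeSet, sdiff_eq_left, Set.disjoint_left]
    exact fun e he => G.not_isDiag_of_mem_edgeSet (hBG he)
  have hle : SimpleGraph.fromEdgeSet B ≤ G := by
    rwa [← SimpleGraph.edgeSet_subset_edgeSet, edgeSet_eq]
  refine ⟨_, hle, by rwa [IsIndependent, edgeSet_eq], (flexSpace_anti hle).antisymm fun u hu => ?_⟩
  rw [mem_flexSpace_iff_rigidityRow, edgeSet_eq] at hu
  refine mem_flexSpace_iff_rigidityRow.2 fun e he => ?_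
  have span_le_ker : Submodule.span ℝ (rigidityRow q p '' B) ≤
      LinearMap.ker ((dotProductBilin ℝ ℝ).flip (coordinates u)) := by
    rw [Submodule.span_le]
    rintro _ ⟨e, he, rfl⟩
    exact hu e he
  exact span_le_ker (hspan ⟨e, he, rfl⟩)

end Rank

section Translations

variable {V : Type*} {d : ℕ} {q : ℝ≥0∞} {G : SimpleGraph V}
  {p : V → PiLp q (fun _ : Fin d => ℝ)}

/-- The families whose members are all equal, that is, the velocities of translations. -/
def translations (V E : Type*) [AddCommGroup E] [Module ℝ E] : Submodule ℝ (V → E) :=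
  LinearMap.range (LinearMap.pi fun _ : V => (LinearMap.id : E →ₗ[ℝ] E))

theorem mem_translations_iff {E : Type*} [AddCommGroup E] [Module ℝ E] [Nonempty V] {u : V → E} :
    u ∈ translations V E ↔ ∀ a b, u a = u b := by
  constructor
  · rintro ⟨x, rfl⟩
    exact fun _ _ => rfl
  · intro h
    exact ⟨u (Classical.arbitrary V), funext fun a => h _ a⟩

theorem finrank_translations [Nonempty V] :
    Module.finrank ℝ (translations V (PiLp q fun _ : Fin d => ℝ)) = d := by
  rw [translations, LinearMap.finrank_range_of_inj, (WithLp.linearEquiv q ℝ (Fin d → ℝ)).finrank_eq,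
    Module.finrank_fin_fun]
  exact fun _ _ h => congrFun h (Classical.arbitrary V)

variable [Fintype V] [DecidableEq V]

theorem translations_le_flexSpace :
    translations V (PiLp q fun _ : Fin d => ℝ) ≤ flexSpace q G p := by
  rintro _ ⟨x, rfl⟩
  exact mem_flexSpace_iff.2 fun a b _ => by simp

theorem IsIndependent.ncard_edgeSet_add_finrank_flexSpace (h : IsIndependent q G p) :
    G.edgeSet.ncard + Module.finrank ℝ (flexSpace q G p) = d * Fintype.card V := by
  rw [← isIndependent_iff_rank_eq.1 h, rank_add_finrank_flexSpace]

variable [Nonempty V]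

theorem IsIndependent.ncard_edgeSet_add_le (h : IsIndependent q G p) :
    G.edgeSet.ncard + d ≤ d * Fintype.card V := by
  have := Submodule.finrank_mono (translations_le_flexSpace (V := V) (G := G) (p := p))
  rwa [finrank_translations, ← Nat.add_le_add_iff_left,
    h.ncard_edgeSet_add_finrank_flexSpace] at this

theorem IsIndependent.flexSpace_eq_translations_iff (h : IsIndependent q G p) :
    flexSpace q G p = translations V (PiLp q fun _ : Fin d => ℝ) ↔
      G.edgeSet.ncard + d = d * Fintype.card V := by
  rw [← h.ncard_edgeSet_add_finrank_flexSpace, Nat.add_left_cancel_iff]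
  constructor
  · intro heq
    rw [heq, finrank_translations]
  · intro heq
    refine (Submodule.eq_of_le_of_finrank_eq translations_le_flexSpace ?_).symm
    rw [← heq, finrank_translations]

end Translations

section Induce

variable {V : Type*} {d : ℕ} {q : ℝ≥0∞} {G : SimpleGraph V} {X : Set V} {a b : V}

theorem edgeCount_eq_ncard_edgeSet_induce (G : SimpleGraph V) (X : Set V) :
    edgeCount G X = (G.induce X).edgeSet.ncard := by
  rw [edgeCount, ← Set.ncard_image_of_injective _ (Sym2.map.injective Subtype.val_injective)]
  congr 1
  ext e
  induction e with | _ x y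
  constructor
  · rintro ⟨hxy, hX⟩
    obtain ⟨hx, hy⟩ := Set.mk_mem_sym2_iff.1 hX
    exact ⟨s(⟨x, hx⟩, ⟨y, hy⟩), hxy, rfl⟩
  · rintro ⟨e, he, hxy⟩
    induction e with | _ x' y'
    rw [← hxy]
    exact ⟨he, Set.mk_mem_sym2_iff.2 ⟨x'.2, y'.2⟩⟩

variable [DecidableEq V]

theorem IsIndependent.induce [Finite V] {p : V → PiLp q (fun _ : Fin d => ℝ)}
    (h : IsIndependent q G p) (X : Set V) : IsIndependent q (G.induce X) fun x : X => p x := by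
  refine isIndependent_iff.2 fun ℓ => ?_
  obtain ⟨u, hu⟩ := isIndependent_iff.1 h (Function.extend (Sym2.map Subtype.val) ℓ 0)
  refine ⟨fun x => u x, fun a b hab => (hu a b hab).trans ?_⟩
  exact (Sym2.map.injective Subtype.val_injective).extend_apply ℓ 0 s(a, b)

variable {p u : V → PiLp q (fun _ : Fin 2 => ℝ)}

theorem IsIndependent.isTwoTwoSparse [Finite V] (h : IsIndependent q G p) : IsTwoTwoSparse G := by
  refine isTwoTwoSparse_iff.2 fun X hX => ?_
  have := Fintype.ofFinite X
  have := hX.to_subtype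
  rw [edgeCount_eq_ncard_edgeSet_induce, ← Set.fintypeCard_eq_ncard X]
  exact (h.induce X).ncard_edgeSet_add_le

theorem IsIndependent.eq_of_isTight [Fintype V] (h : IsIndependent q G p) (hX : IsTight G X)
    (ha : a ∈ X) (hb : b ∈ X) (hu : u ∈ flexSpace q G p) : u a = u b := by
  have := Fintype.ofFinite X
  have : Nonempty X := ⟨⟨a, ha⟩⟩
  rw [IsTight, edgeCount_eq_ncard_edgeSet_induce, ← Set.fintypeCard_eq_ncard X] at hX
  have hflex := (h.induce X).flexSpace_eq_translations_iff.2
    ((h.induce X).ncard_edgeSet_add_le.antisymm hX)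
  have hu' : (fun x : X => u x) ∈ flexSpace q (G.induce X) fun x : X => p x :=
    mem_flexSpace_iff.2 fun a b hab => mem_flexSpace_iff.1 hu a b hab
  rw [hflex] at hu'
  exact mem_translations_iff.1 hu' ⟨a, ha⟩ ⟨b, hb⟩

end Induce

section Flex

variable {V : Type*} {d : ℕ} {q : ℝ≥0∞} [Fact (1 ≤ q)] {G : SimpleGraph V}
  {p u : V → PiLp q (fun _ : Fin d => ℝ)} [Fintype V] [DecidableEq V]

theorem IsInfinitesimalFlex.mem_flexSpace (hq : 1 < q.toReal) (h : IsInfinitesimalFlex G p u) :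
    u ∈ flexSpace q G p := by
  refine mem_flexSpace_iff.2 fun a b hab => ?_
  by_cases heq : p a = p b
  · simp [heq]
  · exact (isLittleO_norm_sub_iff hq heq).1 (h a b hab)

theorem IsIndependent.isInfinitesimalFlex_iff (hq : 1 < q.toReal) (h : IsIndependent q G p) :
    IsInfinitesimalFlex G p u ↔ u ∈ flexSpace q G p := by
  refine ⟨IsInfinitesimalFlex.mem_flexSpace hq, fun hu a b hab => ?_⟩
  exact (isLittleO_norm_sub_iff hq (h.ne_of_adj hab)).2 (mem_flexSpace_iff.1 hu a b hab)

theorem IsIndependent.infinitesimallyRigid_iff [Nonempty V] (hq : 1 < q.toReal)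
    (hq2 : q.toReal ≠ 2) (h : IsIndependent q G p) :
    InfinitesimallyRigid G p ↔ G.edgeSet.ncard + d = d * Fintype.card V := by
  rw [← h.flexSpace_eq_translations_iff, ← translations_le_flexSpace.ge_iff_eq']
  simp only [InfinitesimallyRigid, InfinitesimallyFlexible, h.isInfinitesimalFlex_iff hq,
    isTrivial_iff hq hq2, SetLike.le_def, mem_translations_iff, not_exists, not_and, not_not]

theorem IsIndependent.minimallyInfinitesimallyRigid_iff [Nonempty V] (hq : 1 < q.toReal)
    (hq2 : q.toReal ≠ 2) (h : IsIndependent q G p) :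
    MinimallyInfinitesimallyRigid G p ↔ G.edgeSet.ncard + d = d * Fintype.card V := by
  rw [MinimallyInfinitesimallyRigid, h.infinitesimallyRigid_iff hq hq2, and_iff_left_iff_imp]
  intro hcount e he
  have hdelete := (h.mono (G.deleteEdges_le {e})).infinitesimallyRigid_iff hq hq2
  rw [InfinitesimallyRigid, not_iff_comm] at hdelete
  refine hdelete.1 ?_
  rw [SimpleGraph.edgeSet_deleteEdges, ← hcount, ← Set.ncard_sdiff_singleton_add_one he]
  lia

end Flex

section Regular

variable {V : Type*} [Fintype V] [DecidableEq V] {q : ℝ≥0∞} {G H : SimpleGraph V} {a b : V}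
  {p u : V → PiLp q (fun _ : Fin 2 => ℝ)}

theorem IsRegular.isIndependent (hq : 1 < q.toReal) (hq2 : q.toReal ≠ 2) (hp : IsRegular q G p)
    (hG : IsTwoTwoSparse G) : IsIndependent q G p := by
  obtain ⟨p', hp'⟩ := hG.exists_isIndependent hq hq2
  exact isIndependent_iff_rank_eq.2 (rank_le_ncard_edgeSet.antisymm
    ((isIndependent_iff_rank_eq.1 hp').ge.trans (hp p')))

theorem IsRegular.eq_of_adj_of_not_adj (hq : 1 < q.toReal) (hq2 : q.toReal ≠ 2)
    (hp : IsRegular q G p) (hH : H ≤ G) (h : IsIndependent q H p)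
    (hflex : flexSpace q G p = flexSpace q H p) (hab : G.Adj a b) (hnot : ¬ H.Adj a b)
    (hu : u ∈ flexSpace q H p) : u a = u b := by
  have not_sparse : ¬ IsTwoTwoSparse (H ⊔ SimpleGraph.edge a b) := by
    intro hsparse
    obtain ⟨p', hp'⟩ := hsparse.exists_isIndependent hq hq2
    have hle : H ⊔ SimpleGraph.edge a b ≤ G := sup_le hH (G.edge_le_iff.2 (Or.inr hab))
    have hcard : (H ⊔ SimpleGraph.edge a b).edgeSet.ncard = H.edgeSet.ncard + 1 := by
      rw [SimpleGraph.edgeSet_sup, SimpleGraph.edgeSet_edge_of_ne hab.ne, Set.union_singleton,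
        Set.ncard_insert_of_notMem (H.mem_edgeSet.not.2 hnot)]
    have := (hp'.ncard_edgeSet_le_rank hle).trans (hp p')
    rw [rank_eq_of_flexSpace_eq hflex, isIndependent_iff_rank_eq.1 h] at this
    lia
  obtain ⟨X, hX, ha, hb⟩ := h.isTwoTwoSparse.exists_isTight not_sparse
  exact h.eq_of_isTight hX ha hb hu

theorem IsRegular.isIndependent_of_minimallyInfinitesimallyRigid [Fact (1 ≤ q)]
    (hq : 1 < q.toReal) (hq2 : q.toReal ≠ 2) (hp : IsRegular q G p)
    (hG : MinimallyInfinitesimallyRigid G p) : IsIndependent q G p := by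
  obtain ⟨H, hH, h, hflex⟩ := exists_isIndependent_flexSpace_eq q G p
  suffices H = G from this ▸ h
  by_contra hne
  obtain ⟨e, heG, heH⟩ := Set.exists_of_ssubset
    (SimpleGraph.edgeSet_ssubset_edgeSet.2 (hH.lt_of_ne hne))
  obtain ⟨u, hu, hnontrivial⟩ := hG.2 e heG
  have hle : H ≤ G.deleteEdges {e} := fun a b hab =>
    SimpleGraph.deleteEdges_adj.2 ⟨hH hab, fun heq => heH (heq ▸ hab)⟩
  have hu_mem : u ∈ flexSpace q H p := flexSpace_anti hle (hu.mem_flexSpace hq)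
  refine hG.1 ⟨u, fun a b hab => ?_, hnontrivial⟩
  by_cases hdelete : (G.deleteEdges {e}).Adj a b
  · exact hu a b hdelete
  · have hu_eq : u a = u b :=
      hp.eq_of_adj_of_not_adj hq hq2 hH h hflex hab (fun hab => hdelete (hle hab)) hu_mem
    simp [hu_eq]

end Regular

end BarJoint

theorem theorem3p6 {V : Type*} [Fintype V] [DecidableEq V] [Nonempty V]
    (q : ℝ≥0∞) [Fact (1 ≤ q)] (hq1 : 1 < q) (hqtop : q < ⊤) (hq2 : q ≠ 2)
    (G : SimpleGraph V) (p : V → PiLp q (fun _ : Fin 2 => ℝ))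
    (hp : BarJoint.IsRegular q G p) :
    BarJoint.MinimallyInfinitesimallyRigid G p ↔ BarJoint.IsTwoTwoTight G := by
  have one_lt : 1 < q.toReal := by
    simpa using (ENNReal.toReal_lt_toReal ENNReal.one_ne_top hqtop.ne).2 hq1
  have ne_two : q.toReal ≠ 2 := fun h =>
    hq2 ((ENNReal.toReal_eq_toReal_iff' hqtop.ne ENNReal.ofNat_ne_top).1 (by simpa using h))
  have count_iff : G.edgeSet.ncard + 2 = 2 * Fintype.card V ↔
      (G.edgeSet.ncard : ℤ) = 2 * (Nat.card V : ℤ) - 2 := by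
    rw [Nat.card_eq_fintype_card]
    lia
  rw [BarJoint.IsTwoTwoTight, ← count_iff]
  constructor
  · intro h
    have hind := hp.isIndependent_of_minimallyInfinitesimallyRigid one_lt ne_two h
    exact ⟨hind.isTwoTwoSparse, (hind.minimallyInfinitesimallyRigid_iff one_lt ne_two).1 h⟩
  · rintro ⟨hsparse, hcount⟩
    have hind := hp.isIndependent one_lt ne_two hsparse
    exact (hind.minimallyInfinitesimallyRigid_iff one_lt ne_two).2 hcount
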